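/- Let $G$ be a compact abelian topological group with Haar probability measure $\mu_G$, and let $\widehat G$ be its dual group, i.e. the group of continuous homomorphisms $\gamma : G \to S^1 = \{z\in\mathbb C : |z|=1\}$. For $f\in L^1(G)$ and $\gamma\in\widehat G$ put $\widehat f(\gamma)=\int_G f(x)\overline{\gamma(x)}\,d\mu_G(x)$, and let $$A(G)=\Big\{f\in L^1(G) : \sum_{\gamma\in\widehat G}|\widehat f(\gamma)|<\infty\Big\}.$$ Let $A\subset G$ be a measurable set of density $\alpha=\mu_G(A)$, and write $\chi_A$ for its characteristic function and $\{x\}$ for the fractional part of a real number $x$. **Proposition (Cohen).** If $\{\alpha|V|\}\,(1-\{\alpha|V|\})>0$ for every finite subgroup $V\le\widehat G$, then $\chi_A\notin A(G)$. -/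

import Mathlib

open MeasureTheory

noncomputable section

/-- The Fourier transform `f̂(γ) = ∫ f(x) * conj (γ x) dμ(x)` of a function `f` on a compact
abelian group, as a function on the dual group (the continuous homomorphisms `G → S¹`).
Here `μ` is the Haar probability measure of `G`. -/
def groupFourier {G : Type*} [CommGroup G] [TopologicalSpace G] [MeasurableSpace G]
    (μ : Measure G) (f : G → ℂ) (γ : PontryaginDual G) : ℂ :=
  ∫ x, f x * (starRingEnd ℂ) ((γ x : Circle) : ℂ) ∂μ

/-- The space `A(G)` of all `f ∈ L¹(G)` whose Fourier transform is absolutely summable over the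
dual group. (Membership only depends on the almost everywhere class of `f`.) -/
def fourierAlgebra {G : Type*} [CommGroup G] [TopologicalSpace G] [MeasurableSpace G]
    (μ : Measure G) : Set (G → ℂ) :=
  {f | Integrable f μ ∧ Summable fun γ : PontryaginDual G => ‖groupFourier μ f γ‖}

end

/-! If the indicator of `A` lies in `A(G)`, its Fourier series converges uniformly, so it agrees
almost everywhere with a continuous `h`. Haar measure charges every nonempty open set, so `h * h =
h` everywhere and `h` is the indicator of a clopen `B`. A clopen set in a compact group is a union
of cosets of an open subgroup `H`, so `α * H.index` is an integer. The annihilator `V` of `H` has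
order `H.index`, hence `α|V|` has fractional part zero, a contradiction.

That the series represents the function rests on totality of characters in L²
(`eq_zero_of_forall_inner_character_eq_zero`), proved as in Peter–Weyl: convolution with a Hermitian
kernel is compact, self-adjoint and commutes with translations, so its eigenspaces for nonzero
eigenvalues are finite-dimensional, translation-invariant and spanned by characters. -/

/-! ### Compact operators and common eigenvectors. -/

/-- The operator `v ↦ (x ↦ ⟪K x, v⟫)` attached to a continuous Hilbert-space valued kernel `K`. -/
noncomputable def innerKernelOperator {X E : Type*} [TopologicalSpace X] [CompactSpace X]
    [NormedAddCommGroup E] [InnerProductSpace ℂ E] (K : C(X, E)) : E →L[ℂ] C(X, ℂ) :=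
  LinearMap.mkContinuous
    { toFun := fun v => ⟨fun x => inner ℂ (K x) v, by fun_prop⟩
      map_add' := fun v w => by ext x; simp
      map_smul' := fun c v => by ext x; simp }
    ‖K‖ fun v => by
      refine (ContinuousMap.norm_le _ (by positivity)).2 fun x => ?_
      exact (norm_inner_le_norm _ _).trans
        (mul_le_mul_of_nonneg_right (K.norm_coe_le_norm x) (norm_nonneg _))

@[simp]
theorem innerKernelOperator_apply {X E : Type*} [TopologicalSpace X] [CompactSpace X]
    [NormedAddCommGroup E] [InnerProductSpace ℂ E] (K : C(X, E)) (v : E) (x : X) :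
    innerKernelOperator K v x = inner ℂ (K x) v := rfl

/-- Arzelà–Ascoli: the image of the unit ball is bounded by `‖K‖` and inherits equicontinuity from
the continuity of `K`. -/
theorem isCompactOperator_innerKernelOperator {X E : Type*} [TopologicalSpace X] [CompactSpace X]
    [NormedAddCommGroup E] [InnerProductSpace ℂ E] (K : C(X, E)) :
    IsCompactOperator (innerKernelOperator K) := by
  let e := (BoundedContinuousFunction.mkOfCompact : C(X, ℂ) → BoundedContinuousFunction X ℂ)
  let A : Set (BoundedContinuousFunction X ℂ) :=
    e '' (innerKernelOperator K '' Metric.closedBall 0 1)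
  have hA : IsCompact (closure A) := by
    refine BoundedContinuousFunction.arzela_ascoli (Metric.closedBall 0 ‖K‖)
      (isCompact_closedBall _ _) A ?_ ?_
    · rintro f x ⟨_, ⟨v, hv, rfl⟩, rfl⟩
      simp only [mem_closedBall_zero_iff] at hv ⊢
      calc ‖inner ℂ (K x) v‖ ≤ ‖K x‖ * ‖v‖ := norm_inner_le_norm _ _
        _ ≤ ‖K‖ * 1 := by gcongr; exact K.norm_coe_le_norm x
        _ = ‖K‖ := mul_one _
    · intro x
      rw [Metric.equicontinuousAt_iff_right]
      intro ε hε
      have := Metric.continuousAt_iff'.1 (K.continuous.continuousAt (x := x)) ε hε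
      filter_upwards [this] with y hy
      rintro ⟨_, _, ⟨v, hv, rfl⟩, rfl⟩
      simp only [mem_closedBall_zero_iff] at hv
      change dist (inner ℂ (K x) v) (inner ℂ (K y) v) < ε
      rw [dist_eq_norm, ← inner_sub_left]
      rw [dist_comm, dist_eq_norm] at hy
      calc ‖inner ℂ (K x - K y) v‖ ≤ ‖K x - K y‖ * ‖v‖ := norm_inner_le_norm _ _
        _ ≤ ‖K x - K y‖ * 1 := by gcongr
        _ < ε := by simpa using hy
  refine ⟨ContinuousMap.equivBoundedOfCompact X ℂ ⁻¹' closure A, ?_, ?_⟩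
  · exact (ContinuousMap.isometryEquivBoundedOfCompact X ℂ).toHomeomorph.isCompact_preimage.2 hA
  · filter_upwards [Metric.closedBall_mem_nhds (0 : E) one_pos] with v hv
    exact subset_closure ⟨_, ⟨v, hv, rfl⟩, rfl⟩

/-- A commuting family of endomorphisms leaving a nonzero finite-dimensional complex subspace
invariant has a common eigenvector in it. -/
theorem exists_common_eigenvector {ι V : Type*} [AddCommGroup V] [Module ℂ V]
    (ρ : ι → Module.End ℂ V) (hρ : ∀ i j, Commute (ρ i) (ρ j)) (M : Submodule ℂ V)
    [FiniteDimensional ℂ M] (hM : M ≠ ⊥) (hinv : ∀ i, ∀ v ∈ M, ρ i v ∈ M) :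
    ∃ v ∈ M, v ≠ 0 ∧ ∀ i, ∃ c : ℂ, ρ i v = c • v := by
  induction hn : Module.finrank ℂ M using Nat.strong_induction_on generalizing M with
  | _ n ih =>
    subst hn
    by_cases h : ∀ v ∈ M, ∀ i, ∃ c : ℂ, ρ i v = c • v
    · obtain ⟨v, hv, hv0⟩ := Submodule.exists_mem_ne_zero_of_ne_bot hM
      exact ⟨v, hv, hv0, h v hv⟩
    push Not at h
    obtain ⟨w, hw, i, hwi⟩ := h
    have : Nontrivial M := Submodule.nontrivial_iff_ne_bot.2 hM
    obtain ⟨c, hc⟩ := Module.End.exists_eigenvalue ((ρ i).restrict (hinv i))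
    obtain ⟨⟨u, hu⟩, huc⟩ := hc.exists_hasEigenvector
    have hcu : ρ i u = c • u := congrArg Subtype.val huc.apply_eq_smul
    have hu0 : u ≠ 0 := fun h => huc.2 (Subtype.ext h)
    -- `w` is no eigenvector of `ρ i`, so `M'` is strictly smaller; commutation keeps it invariant.
    let M' := M ⊓ (ρ i).eigenspace c
    have hlt : M' < M := by
      refine lt_of_le_of_ne inf_le_left fun h => hwi c ?_
      exact Module.End.mem_eigenspace_iff.1 ((h.symm ▸ hw : w ∈ M').2)
    have : FiniteDimensional ℂ M' := Submodule.finiteDimensional_of_le hlt.le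
    obtain ⟨v, hv, h⟩ := ih _ (Submodule.finrank_lt_finrank_of_lt hlt) M'
      (fun h => hu0 ((Submodule.eq_bot_iff _).1 h u ⟨hu, Module.End.mem_eigenspace_iff.2 hcu⟩))
      (fun j v hv => ⟨hinv j v hv.1, by
        have := Module.End.mem_eigenspace_iff.1 hv.2
        refine Module.End.mem_eigenspace_iff.2 ?_
        rw [← Module.End.mul_apply, (hρ i j).eq, Module.End.mul_apply, this, map_smul]⟩) rfl
    exact ⟨v, hv.1, h⟩

/-! ### Open subgroups: cosets, measure and annihilators. -/

theorem exists_openSubgroup_mul_mem_of_isClopen {G : Type*} [Group G] [TopologicalSpace G]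
    [IsTopologicalGroup G] [CompactSpace G] {B : Set G} (hB : IsClopen B) :
    ∃ H : Subgroup G, IsOpen (H : Set G) ∧ ∀ b ∈ B, ∀ h ∈ H, b * h ∈ B := by
  obtain ⟨T, hT, hTB⟩ := IsTopologicalGroup.exist_mul_closure_nhds hB
  refine ⟨Subgroup.closure (T ∩ T⁻¹), ?_, ?_⟩
  · refine Subgroup.isOpen_of_mem_nhds _ (g := 1) ?_
    exact Filter.mem_of_superset (Filter.inter_mem hT (inv_mem_nhds_one G hT))
      Subgroup.subset_closure
  -- The equivalence, unlike the one-way implication, passes to inverses.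
  · suffices ∀ h ∈ Subgroup.closure (T ∩ T⁻¹), ∀ b, b ∈ B ↔ b * h ∈ B from
      fun b hb h hh => (this h hh b).1 hb
    intro h hh
    induction hh using Subgroup.closure_induction with
    | mem x hx =>
      refine fun b => ⟨fun hb => hTB (Set.mul_mem_mul hb hx.1), fun hb => ?_⟩
      simpa using hTB (Set.mul_mem_mul hb hx.2)
    | one => simp
    | mul x y _ _ hx hy => intro b; rw [← mul_assoc, ← hy, ← hx]
    | inv x _ hx => intro b; rw [hx (b * x⁻¹), inv_mul_cancel_right]

/-- `B` is a disjoint union of cosets of `H`, each of measure `1 / H.index`. -/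
theorem measureReal_mul_index_eq_ncard {G : Type*} [Group G] [TopologicalSpace G]
    [IsTopologicalGroup G] [CompactSpace G] [MeasurableSpace G] [BorelSpace G] (μ : Measure G)
    [μ.IsMulLeftInvariant] [IsProbabilityMeasure μ] {B : Set G} {H : Subgroup G}
    (hH : IsOpen (H : Set G)) (hB : ∀ b ∈ B, ∀ h ∈ H, b * h ∈ B) :
    μ.real B * H.index = (((↑) : G → G ⧸ H) '' B).ncard := by
  classical
  have : Finite (G ⧸ H) := H.quotient_finite_of_isOpen hH
  have : Fintype (G ⧸ H) := Fintype.ofFinite _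
  have hcoset (q : G ⧸ H) : μ.real (((↑) : G → G ⧸ H) ⁻¹' {q}) = μ.real (H : Set G) := by
    obtain ⟨g, rfl⟩ := QuotientGroup.mk_surjective q
    have : ((↑) : G → G ⧸ H) ⁻¹' {(g : G ⧸ H)} = (g⁻¹ * ·) ⁻¹' (H : Set G) := by
      ext x
      simp only [Set.mem_preimage, Set.mem_singleton_iff, SetLike.mem_coe]
      rw [eq_comm, QuotientGroup.eq]
    rw [this, measureReal_def, measure_preimage_mul, measureReal_def]
  have hmeas (q : G ⧸ H) : MeasurableSet (((↑) : G → G ⧸ H) ⁻¹' {q}) := by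
    have : DiscreteTopology (G ⧸ H) := QuotientGroup.discreteTopology hH
    exact ((isOpen_discrete {q}).preimage continuous_quotient_mk').measurableSet
  have key (S : Finset (G ⧸ H)) : μ.real (((↑) : G → G ⧸ H) ⁻¹' S) = S.card * μ.real (H : Set G) := by
    have : ((↑) : G → G ⧸ H) ⁻¹' S = ⋃ q ∈ S, ((↑) : G → G ⧸ H) ⁻¹' {q} := by
      ext; simp
    rw [this, measureReal_biUnion_finset]
    · simp [hcoset]
    · intro p _ q _ hpq
      exact Disjoint.preimage _ (by simpa using hpq)
    · exact fun q _ => hmeas q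
  have hone : (H.index : ℝ) * μ.real (H : Set G) = 1 := by
    have := key Finset.univ
    simpa [Subgroup.index, Nat.card_eq_fintype_card] using this.symm
  have hsat : B = ((↑) : G → G ⧸ H) ⁻¹' (((↑) : G → G ⧸ H) '' B) := by
    refine Set.Subset.antisymm (Set.subset_preimage_image _ _) ?_
    rintro x ⟨b, hb, hbx⟩
    have := hB b hb _ (QuotientGroup.eq.1 hbx)
    simpa using this
  have := key (((↑) : G → G ⧸ H) '' B).toFinset
  rw [Set.coe_toFinset, ← hsat, ← Set.ncard_eq_toFinset_card'] at this
  rw [this, mul_assoc, mul_comm (μ.real _), hone, mul_one]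

/-- The characters that are trivial on `H`. -/
def PontryaginDual.annihilator {G : Type*} [CommGroup G] [TopologicalSpace G] (H : Subgroup G) :
    Subgroup (PontryaginDual G) where
  carrier := {γ | ∀ h ∈ H, γ h = 1}
  mul_mem' := fun {a b} ha hb h hh => by
    change a h * b h = 1
    rw [ha h hh, hb h hh, mul_one]
  one_mem' := fun _ _ => rfl
  inv_mem' := fun {a} ha h hh => by
    change (a h)⁻¹ = 1
    rw [ha h hh, inv_one]

noncomputable def PontryaginDual.annihilatorEquiv {G : Type*} [CommGroup G] [TopologicalSpace G]
    [IsTopologicalGroup G] {H : Subgroup G} (hH : IsOpen (H : Set G)) :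
    PontryaginDual.annihilator H ≃ (G ⧸ H →* Circle) where
  toFun γ := QuotientGroup.lift H (γ.1 : G →* Circle) γ.2
  invFun φ := ⟨⟨φ.comp (QuotientGroup.mk' H), by
      have : DiscreteTopology (G ⧸ H) := QuotientGroup.discreteTopology hH
      exact (continuous_of_discreteTopology (f := φ)).comp continuous_quotient_mk'⟩, fun h hh => by
      change φ (h : G ⧸ H) = 1
      rw [(QuotientGroup.eq_one_iff h).2 hh]
      exact _root_.map_one φ⟩
  left_inv γ := rfl
  right_inv φ := by ext x; rfl

theorem PontryaginDual.card_annihilator {G : Type*} [CommGroup G] [TopologicalSpace G]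
    [IsTopologicalGroup G] {H : Subgroup G} [Finite (G ⧸ H)] (hH : IsOpen (H : Set G)) :
    Nat.card (PontryaginDual.annihilator H) = H.index := by
  rw [Nat.card_congr (PontryaginDual.annihilatorEquiv hH), Subgroup.index]
  have e : (G ⧸ H →* Circle) ≃ (G ⧸ H →* Circleˣ) := (toUnits.monoidHomCongrRight).toEquiv
  rw [Nat.card_congr e, CommGroup.card_monoidHom_of_hasEnoughRootsOfUnity]

/-- A character as a continuous complex-valued function. -/
noncomputable def PontryaginDual.toContinuousMap {G : Type*} [CommGroup G] [TopologicalSpace G]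
    (γ : PontryaginDual G) : C(G, ℂ) :=
  ⟨fun x => (γ x : ℂ), continuous_subtype_val.comp (map_continuous γ)⟩

/-! ### Totality of characters in L². -/

section CompactGroup

variable {G : Type*} [CommGroup G] [TopologicalSpace G] [IsTopologicalGroup G]
  [CompactSpace G] [MeasurableSpace G] [BorelSpace G]
  (μ : Measure G) [IsProbabilityMeasure μ]

/-- A continuous function on `G` as an element of `L²(G)`. -/
noncomputable abbrev toL2 : C(G, ℂ) →L[ℂ] Lp ℂ 2 μ := ContinuousMap.toLp 2 μ ℂ

theorem inner_toL2 (f : C(G, ℂ)) (v : Lp ℂ 2 μ) :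
    inner ℂ (toL2 μ f) v = ∫ x, v x * starRingEnd ℂ (f x) ∂μ := by
  rw [L2.inner_def]
  refine integral_congr_ae ?_
  filter_upwards [ContinuousMap.coeFn_toLp (p := 2) (𝕜 := ℂ) μ f] with x hx
  rw [hx]; rfl

theorem inner_toL2_toL2 (f g : C(G, ℂ)) :
    inner ℂ (toL2 μ f) (toL2 μ g) = ∫ x, g x * starRingEnd ℂ (f x) ∂μ := by
  rw [inner_toL2]
  refine integral_congr_ae ?_
  filter_upwards [ContinuousMap.coeFn_toLp (p := 2) (𝕜 := ℂ) μ g] with y hy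
  rw [hy]

theorem toL2_denseRange [μ.Regular] : DenseRange (toL2 μ) :=
  ContinuousMap.toLp_denseRange ℂ μ ℂ (by norm_num)

/-- The kernel `x ↦ q (x⁻¹ * ·)`. -/
noncomputable def translationKernel (q : C(G, ℂ)) : C(G, Lp ℂ 2 μ) :=
  (toL2 μ : C(C(G, ℂ), Lp ℂ 2 μ)).comp
    (ContinuousMap.curry ⟨fun p : G × G => q (p.1⁻¹ * p.2), by fun_prop⟩)

/-- Convolution with `z ↦ conj (q z⁻¹)`, from `L²` to continuous functions. -/
noncomputable abbrev convToContinuous (q : C(G, ℂ)) : Lp ℂ 2 μ →L[ℂ] C(G, ℂ) :=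
  innerKernelOperator (translationKernel μ q)

/-- Convolution with `z ↦ conj (q z⁻¹)` as an operator on `L²`. -/
noncomputable def convL2 (q : C(G, ℂ)) : Lp ℂ 2 μ →L[ℂ] Lp ℂ 2 μ :=
  (toL2 μ).comp (convToContinuous μ q)

theorem isCompactOperator_convL2 (q : C(G, ℂ)) : IsCompactOperator (convL2 μ q) :=
  (isCompactOperator_innerKernelOperator (translationKernel μ q)).clm_comp (toL2 μ)

variable [μ.IsMulLeftInvariant]

theorem smul_toL2 (g : G) (f : C(G, ℂ)) :
    DomMulAct.mk g • toL2 μ f = toL2 μ (f.comp (ContinuousMap.mulLeft g)) := by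
  rfl

theorem smul_toL2_character (g : G) (γ : PontryaginDual G) :
    DomMulAct.mk g • toL2 μ γ.toContinuousMap = (γ g : ℂ) • toL2 μ γ.toContinuousMap := by
  rw [smul_toL2, ← map_smul]
  congr 1
  ext x
  change ((γ (g * x) : Circle) : ℂ) = γ g * γ x
  rw [map_mul]; simp

theorem inner_smul_smul_L2 (g : Gᵈᵐᵃ) (v w : Lp ℂ 2 μ) :
    inner ℂ (g • v) (g • w) = inner ℂ v w := by
  let e : Lp ℂ 2 μ →ₗᵢ[ℂ] Lp ℂ 2 μ :=
    ⟨DistribSMul.toLinearMap ℂ (Lp ℂ 2 μ) g, DomMulAct.norm_smul_Lp g⟩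
  exact e.inner_map_map v w

theorem inner_smul_left_L2 (g : Gᵈᵐᵃ) (v w : Lp ℂ 2 μ) :
    inner ℂ (g • v) w = inner ℂ v (g⁻¹ • w) := by
  rw [← inner_smul_smul_L2 μ g v, smul_inv_smul]

theorem convToContinuous_smul (q : C(G, ℂ)) (g : G) (v : Lp ℂ 2 μ) :
    convToContinuous μ q (DomMulAct.mk g • v) =
      (convToContinuous μ q v).comp (ContinuousMap.mulLeft g) := by
  ext x
  -- The kernel at `x` is a translate of `q`, so unitarity moves the translation by `g` onto it.
  change inner ℂ ((DomMulAct.mk x)⁻¹ • toL2 μ q) _ = inner ℂ ((DomMulAct.mk (g * x))⁻¹ • toL2 μ q) v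
  rw [← inv_inv (DomMulAct.mk g), ← inner_smul_left_L2, smul_smul, mul_comm g x,
    DomMulAct.mk_mul, mul_inv_rev, mul_comm]

theorem convL2_smul (q : C(G, ℂ)) (g : G) (v : Lp ℂ 2 μ) :
    convL2 μ q (DomMulAct.mk g • v) = DomMulAct.mk g • convL2 μ q v := by
  simp only [convL2, ContinuousLinearMap.comp_apply, convToContinuous_smul, smul_toL2]

theorem convToContinuous_toL2 (q f : C(G, ℂ)) (x : G) :
    convToContinuous μ q (toL2 μ f) x = ∫ y, f y * starRingEnd ℂ (q (x⁻¹ * y)) ∂μ := by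
  change inner ℂ (DomMulAct.mk x⁻¹ • toL2 μ q) _ = _
  rw [smul_toL2, inner_toL2]
  refine integral_congr_ae ?_
  filter_upwards [ContinuousMap.coeFn_toLp (p := 2) (𝕜 := ℂ) μ f] with y hy
  rw [hy]; rfl

/-- A nonzero continuous function spanning a translation-invariant line is a multiple
of a character. -/
theorem exists_character_of_smul_eq [μ.IsOpenPosMeasure] {ψ : C(G, ℂ)} (hψ : toL2 μ ψ ≠ 0) {c : G → ℂ}
    (hc : ∀ g, DomMulAct.mk g • toL2 μ ψ = c g • toL2 μ ψ) :
    ∃ γ : PontryaginDual G, ∃ a : ℂ, a ≠ 0 ∧ ψ = a • γ.toContinuousMap := by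
  have hmul (g x : G) : ψ (g * x) = c g * ψ x := by
    have : ψ.comp (ContinuousMap.mulLeft g) = c g • ψ := by
      apply ContinuousMap.toLp_injective (p := 2) (𝕜 := ℂ) μ
      rw [map_smul]
      exact hc g
    exact congrArg (fun f : C(G, ℂ) => f x) this
  have hval (g : G) : ψ g = c g * ψ 1 := by simpa using hmul g 1
  have h1 : ψ 1 ≠ 0 := by
    intro h0
    refine hψ ?_
    have : ψ = 0 := by ext g; simp [hval g, h0]
    simp [this]
  have hcval (g : G) : c g = ψ g / ψ 1 := by rw [hval, mul_div_cancel_right₀ _ h1]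
  have hnorm (g : G) : ‖c g‖ = 1 := by
    have := congrArg norm (hc g)
    rw [DomMulAct.norm_smul_Lp, norm_smul] at this
    exact (mul_eq_right₀ (norm_ne_zero_iff.2 hψ)).1 this.symm
  have hcmul (g h : G) : c (g * h) = c g * c h := by
    rw [hcval, hmul, hcval h, mul_div_assoc]
  let γ : G →ₜ* Circle :=
    { toFun g := ⟨c g, mem_sphere_zero_iff_norm.2 (hnorm g)⟩
      map_one' := by ext; simp [hcval, h1]
      map_mul' g h := by ext; exact hcmul g h
      continuous_toFun := by
        refine Continuous.subtype_mk ?_ _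
        simp only [funext hcval]
        fun_prop }
  refine ⟨γ, ψ 1, h1, ?_⟩
  ext g
  rw [hval, mul_comm]; rfl

/-- A function orthogonal to all characters is orthogonal to the eigenspaces of `convL2 μ q` for
nonzero eigenvalues. -/
theorem inner_eq_zero_of_mem_eigenspace_convL2 [μ.IsOpenPosMeasure] (q : C(G, ℂ)) {c : ℂ} (hc : c ≠ 0)
    {f : Lp ℂ 2 μ} (hf : ∀ γ : PontryaginDual G, inner ℂ (toL2 μ γ.toContinuousMap) f = 0)
    {v : Lp ℂ 2 μ} (hv : v ∈ Module.End.eigenspace (convL2 μ q).toLinearMap c) :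
    inner ℂ v f = 0 := by
  set E := Module.End.eigenspace (convL2 μ q).toLinearMap c
  have : FiniteDimensional ℂ E :=
    ContinuousLinearMap.finite_dimensional_eigenspace (isCompactOperator_convL2 μ q) c hc
  have hE (g : G) (w) (hw : w ∈ E) : DomMulAct.mk g • w ∈ E := by
    have h : convL2 μ q w = c • w := Module.End.mem_eigenspace_iff.1 hw
    refine Module.End.mem_eigenspace_iff.2 ?_
    change convL2 μ q (DomMulAct.mk g • w) = _
    rw [convL2_smul, h, smul_comm]
  -- `X` is spanned by the characters in `E`. A common eigenvector of the translations in `E ⊓ Xᗮ`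
  -- would be a multiple of a character, hence in both `X` and `Xᗮ`.
  let X := Submodule.span ℂ
    {w | w ∈ E ∧ ∃ γ : PontryaginDual G, w = toL2 μ γ.toContinuousMap}
  have hXE : X ≤ E := Submodule.span_le.2 fun w hw => hw.1
  have : FiniteDimensional ℂ X := Submodule.finiteDimensional_of_le hXE
  have : FiniteDimensional ℂ (E ⊓ Xᗮ : Submodule ℂ (Lp ℂ 2 μ)) :=
    Submodule.finiteDimensional_of_le inf_le_left
  have hM : E ⊓ Xᗮ = ⊥ := by
    by_contra hne
    obtain ⟨w, hw, hw0, hev⟩ := exists_common_eigenvector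
      (fun g : G => DistribSMul.toLinearMap ℂ (Lp ℂ 2 μ) (DomMulAct.mk g))
      (fun g h => by
        ext1 w
        change DomMulAct.mk g • DomMulAct.mk h • w = DomMulAct.mk h • DomMulAct.mk g • w
        rw [smul_smul, smul_smul, mul_comm]) (E ⊓ Xᗮ) hne
      (fun g w hw => by
        refine ⟨hE g w hw.1, ?_⟩
        change DomMulAct.mk g • w ∈ Xᗮ
        rw [Submodule.mem_orthogonal]
        intro u hu
        induction hu using Submodule.span_induction with
        | mem u hu =>
          obtain ⟨huE, γ, rfl⟩ := hu
          rw [← inv_inv (DomMulAct.mk g), ← inner_smul_left_L2]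
          change inner ℂ (DomMulAct.mk g⁻¹ • _) w = _
          rw [smul_toL2_character, inner_smul_left,
            (Submodule.mem_orthogonal _ _).1 hw.2 _ (Submodule.subset_span ⟨huE, γ, rfl⟩), mul_zero]
        | zero => simp
        | add a b _ _ ha hb => rw [inner_add_left, ha, hb, add_zero]
        | smul r a _ ha => rw [inner_smul_left, ha, mul_zero])
    choose d hd using hev
    have hwc : convL2 μ q w = c • w := Module.End.mem_eigenspace_iff.1 hw.1
    -- As `c ≠ 0`, the eigenvector `w` is in the range of the convolution and so has a continuous
    -- representative.
    have hψ : toL2 μ (c⁻¹ • convToContinuous μ q w) = w := by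
      rw [map_smul]
      change c⁻¹ • convL2 μ q w = w
      rw [hwc, inv_smul_smul₀ hc]
    obtain ⟨γ, a, ha, hγ⟩ := exists_character_of_smul_eq μ (c := d) (by rwa [hψ]) (by rwa [hψ])
    rw [hγ, map_smul] at hψ
    have hmem : toL2 μ γ.toContinuousMap = a⁻¹ • w := by rw [← hψ, inv_smul_smul₀ ha]
    have h0 := (Submodule.mem_orthogonal _ _).1 hw.2 _
      (Submodule.subset_span ⟨hmem ▸ E.smul_mem _ hw.1, γ, rfl⟩)
    rw [hmem, inner_smul_left] at h0
    simp [ha, hw0] at h0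
  have hvX : v ∈ X := by
    have : v - X.starProjection v ∈ E ⊓ Xᗮ :=
      ⟨E.sub_mem hv (hXE (Submodule.starProjection_apply_mem _ _)),
        Submodule.sub_starProjection_mem_orthogonal v⟩
    rw [hM, Submodule.mem_bot, sub_eq_zero] at this
    rw [this]
    exact Submodule.starProjection_apply_mem _ _
  clear hv
  induction hvX using Submodule.span_induction with
  | mem u hu => obtain ⟨-, γ, rfl⟩ := hu; exact hf γ
  | zero => simp
  | add a b _ _ ha hb => rw [inner_add_left, ha, hb, add_zero]
  | smul r a _ ha => rw [inner_smul_left, ha, mul_zero]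

variable [μ.Regular]

/-- Fubini for continuous functions, then density in each variable. -/
theorem isSymmetric_convL2 (q : C(G, ℂ)) (hq : ∀ z, q z⁻¹ = starRingEnd ℂ (q z)) :
    (convL2 μ q).IsSymmetric := by
  have key : ∀ f g : C(G, ℂ), inner ℂ (convL2 μ q (toL2 μ f)) (toL2 μ g) =
      inner ℂ (toL2 μ f) (convL2 μ q (toL2 μ g)) := by
    intro f g
    simp only [convL2, ContinuousLinearMap.comp_apply]
    rw [inner_toL2_toL2, inner_toL2_toL2]
    simp only [convToContinuous_toL2, ← integral_conj, ← integral_const_mul, ← integral_mul_const]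
    rw [integral_integral_swap_of_hasCompactSupport]
    · refine integral_congr_ae (.of_forall fun y => integral_congr_ae (.of_forall fun x => ?_))
      have := hq (x⁻¹ * y)
      simp only [mul_inv_rev, inv_inv] at this
      simp only [map_mul, Complex.conj_conj, this]
      ring
    · simp only [Function.uncurry_def]
      fun_prop
    · exact HasCompactSupport.of_compactSpace _
  intro v w
  have h1 : ∀ f : C(G, ℂ), inner ℂ (convL2 μ q (toL2 μ f)) w =
      inner ℂ (toL2 μ f) (convL2 μ q w) := fun f =>
    congrFun ((toL2_denseRange μ).equalizer
      (g := fun w => inner ℂ (convL2 μ q (toL2 μ f)) w)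
      (h := fun w => inner ℂ (toL2 μ f) (convL2 μ q w))
      (by fun_prop) (by fun_prop) (funext fun g => key f g)) w
  exact congrFun ((toL2_denseRange μ).equalizer (g := fun v => inner ℂ (convL2 μ q v) w)
    (h := fun v => inner ℂ v (convL2 μ q w)) (by fun_prop) (by fun_prop) (funext h1)) v

variable [μ.IsOpenPosMeasure]

/-- By symmetry `convL2 μ q f` is orthogonal to all eigenspaces, so it vanishes by the spectral
theorem; its continuous version at `1` is the desired inner product. -/
theorem inner_toL2_eq_zero_of_hermitian {f : Lp ℂ 2 μ}
    (hf : ∀ γ : PontryaginDual G, inner ℂ (toL2 μ γ.toContinuousMap) f = 0)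
    {q : C(G, ℂ)} (hq : ∀ z, q z⁻¹ = starRingEnd ℂ (q z)) : inner ℂ (toL2 μ q) f = 0 := by
  have hsymm := isSymmetric_convL2 μ q hq
  have h0 : convL2 μ q f = 0 := by
    have := ContinuousLinearMap.orthogonalComplement_iSup_eigenspaces_eq_bot
      (isCompactOperator_convL2 μ q) hsymm
    rw [← Submodule.mem_bot ℂ, ← this, ← Submodule.iInf_orthogonal, Submodule.mem_iInf]
    intro c
    rw [Submodule.mem_orthogonal]
    intro v hv
    have hvc : convL2 μ q v = c • v := Module.End.mem_eigenspace_iff.1 hv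
    have h : inner ℂ v (convL2 μ q f) = inner ℂ (convL2 μ q v) f := (hsymm v f).symm
    rw [h, hvc, inner_smul_left]
    by_cases hc : c = 0
    · simp [hc]
    · rw [inner_eq_zero_of_mem_eigenspace_convL2 μ q hc hf hv, mul_zero]
  have h1 : convToContinuous μ q f = 0 := by
    apply ContinuousMap.toLp_injective (p := 2) (𝕜 := ℂ) μ
    rw [map_zero]; exact h0
  have h2 : inner ℂ ((DomMulAct.mk (1 : G))⁻¹ • toL2 μ q) f = 0 :=
    congrArg (fun u : C(G, ℂ) => u 1) h1
  simpa using h2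

/-- Characters of a compact abelian group are total in `L²`. -/
theorem eq_zero_of_forall_inner_character_eq_zero {f : Lp ℂ 2 μ}
    (hf : ∀ γ : PontryaginDual G, inner ℂ (toL2 μ γ.toContinuousMap) f = 0) : f = 0 := by
  have h (q : C(G, ℂ)) : inner ℂ (toL2 μ q) f = 0 := by
    -- Both `q + r` and `I • (q - r)` are Hermitian, and together they recover `q`.
    let r : C(G, ℂ) := ⟨fun z => starRingEnd ℂ (q z⁻¹), by fun_prop⟩
    have h1 := inner_toL2_eq_zero_of_hermitian μ hf (q := q + r) fun z => by
      simp [r, add_comm]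
    have h2 := inner_toL2_eq_zero_of_hermitian μ hf (q := Complex.I • (q - r)) fun z => by
      simp [r]
      ring
    rw [map_add, inner_add_left] at h1
    rw [map_smul, inner_smul_left, map_sub, inner_sub_left] at h2
    have h3 : inner ℂ (toL2 μ q) f - inner ℂ (toL2 μ r) f = 0 := by simpa using h2
    linear_combination (h1 + h3) / 2
  have := congrFun ((toL2_denseRange μ).equalizer (g := fun v => inner ℂ v f)
    (h := fun _ => (0 : ℂ)) (by fun_prop) (by fun_prop) (funext h)) f
  exact inner_self_eq_zero.1 this

end CompactGroup

/-! ### Orthonormality and absolutely convergent Fourier series. -/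

section FourierSeries

variable {G : Type*} [CommGroup G] [TopologicalSpace G] [IsTopologicalGroup G]
  [CompactSpace G] [MeasurableSpace G] [BorelSpace G]
  (μ : Measure G) [IsProbabilityMeasure μ] [μ.IsMulLeftInvariant]

theorem inner_character_self (γ : PontryaginDual G) :
    inner ℂ (toL2 μ γ.toContinuousMap) (toL2 μ γ.toContinuousMap) = (1 : ℂ) := by
  rw [inner_toL2_toL2]
  have (x : G) : γ.toContinuousMap x * starRingEnd ℂ (γ.toContinuousMap x) = 1 := by
    rw [Complex.mul_conj']
    have : ‖γ.toContinuousMap x‖ = 1 := Circle.norm_coe (γ x)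
    rw [this]; simp
  simp [this]

/-- Translation by `g` preserves the inner product yet scales it by `conj (γ g) * δ g`, which is not
`1` when `γ g ≠ δ g`. -/
theorem inner_character_of_ne {γ δ : PontryaginDual G} (h : γ ≠ δ) :
    inner ℂ (toL2 μ γ.toContinuousMap) (toL2 μ δ.toContinuousMap) = (0 : ℂ) := by
  obtain ⟨g, hg⟩ : ∃ g, γ g ≠ δ g := by
    by_contra! hall
    exact h (PontryaginDual.ext hall)
  have key := inner_smul_smul_L2 μ (DomMulAct.mk g)
    (toL2 μ γ.toContinuousMap) (toL2 μ δ.toContinuousMap)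
  rw [smul_toL2_character, smul_toL2_character, inner_smul_left, inner_smul_right, ← mul_assoc] at key
  by_contra hne
  have h1 := (mul_eq_right₀ hne).1 key
  apply hg
  have h2 : (γ g : ℂ) * starRingEnd ℂ (γ g : ℂ) = 1 := by
    rw [Complex.mul_conj', Circle.norm_coe]; simp
  ext
  linear_combination (γ g : ℂ) * (-h1) + (δ g : ℂ) * h2

theorem norm_character_le_one (γ : PontryaginDual G) : ‖γ.toContinuousMap‖ ≤ 1 := by
  refine (ContinuousMap.norm_le _ zero_le_one).2 fun x => ?_
  exact (Circle.norm_coe (γ x)).le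

/-- A square-integrable function with summable Fourier coefficients agrees almost everywhere with
a continuous function. -/
theorem exists_continuous_ae_eq_of_mem_fourierAlgebra [μ.Regular] [μ.IsOpenPosMeasure] {f : G → ℂ}
    (hf : MemLp f 2 μ) (hfA : f ∈ fourierAlgebra μ) : ∃ h : C(G, ℂ), f =ᵐ[μ] h := by
  have hsum : Summable fun γ : PontryaginDual G => groupFourier μ f γ • γ.toContinuousMap := by
    refine Summable.of_norm_bounded hfA.2 fun γ => ?_
    rw [norm_smul]
    exact mul_le_of_le_one_right (norm_nonneg _) (norm_character_le_one γ)
  refine ⟨∑' γ : PontryaginDual G, groupFourier μ f γ • γ.toContinuousMap, ?_⟩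
  set h := ∑' γ : PontryaginDual G, groupFourier μ f γ • γ.toContinuousMap
  have hcoeff (δ : PontryaginDual G) :
      inner ℂ (toL2 μ δ.toContinuousMap) (toL2 μ h) = groupFourier μ f δ := by
    have h1 : HasSum (fun γ : PontryaginDual G => inner ℂ (toL2 μ δ.toContinuousMap)
        (toL2 μ (groupFourier μ f γ • γ.toContinuousMap)))
        (inner ℂ (toL2 μ δ.toContinuousMap) (toL2 μ h)) :=
      hsum.hasSum.mapL ((innerSL ℂ (toL2 μ δ.toContinuousMap)).comp (toL2 μ))
    have h2 := hasSum_single (f := fun γ : PontryaginDual G => (inner ℂ (toL2 μ δ.toContinuousMap)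
        (toL2 μ (groupFourier μ f γ • γ.toContinuousMap)) : ℂ)) δ fun γ hγ => by
      rw [map_smul, inner_smul_right, inner_character_of_ne μ hγ.symm, mul_zero]
    rw [h1.unique h2, map_smul, inner_smul_right, inner_character_self, mul_one]
  have hfc (δ : PontryaginDual G) :
      inner ℂ (toL2 μ δ.toContinuousMap) (hf.toLp f) = groupFourier μ f δ := by
    rw [inner_toL2]
    refine integral_congr_ae ?_
    filter_upwards [hf.coeFn_toLp] with x hx
    rw [hx]; rfl
  have h0 : hf.toLp f - toL2 μ h = 0 := eq_zero_of_forall_inner_character_eq_zero μ fun δ => by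
    rw [inner_sub_right, hcoeff, hfc, sub_self]
  have h1 := hf.coeFn_toLp
  rw [sub_eq_zero.1 h0] at h1
  exact h1.symm.trans (ContinuousMap.coeFn_toLp (p := 2) (𝕜 := ℂ) μ h)

end FourierSeries

/-! ### From continuity to a clopen set, and the conclusion. -/

/-- If an indicator function agrees almost everywhere with a continuous function, then the set
agrees almost everywhere with a clopen set. -/
theorem exists_isClopen_ae_eq_of_indicator_ae_eq {X : Type*} [TopologicalSpace X]
    [MeasurableSpace X] [BorelSpace X] {μ : Measure X} [μ.IsOpenPosMeasure] {A : Set X} {h : C(X, ℂ)}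
    (hA : A.indicator (fun _ => (1 : ℂ)) =ᵐ[μ] h) : ∃ B : Set X, IsClopen B ∧ A =ᵐ[μ] B := by
  classical
  have hidem : (fun x => h x * h x) = h := by
    refine Continuous.ae_eq_iff_eq μ (by fun_prop) (by fun_prop) |>.1 ?_
    filter_upwards [hA] with x hx
    rw [← hx, Set.indicator_apply]
    split_ifs <;> simp
  have h01 (x : X) : h x = 0 ∨ h x = 1 := by
    have := congrFun hidem x
    by_cases h0 : h x = 0
    · exact .inl h0
    · exact .inr ((mul_eq_right₀ h0).1 this)
  refine ⟨h ⁻¹' {1}, ⟨isClosed_singleton.preimage h.continuous, ?_⟩, ?_⟩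
  · have : h ⁻¹' {1} = h ⁻¹' {0}ᶜ := by
      ext x
      rcases h01 x with hx | hx <;> simp [hx]
    rw [this]
    exact isOpen_compl_singleton.preimage h.continuous
  · filter_upwards [hA] with x hx
    refine propext ?_
    change x ∈ A ↔ h x = 1
    rw [← hx, Set.indicator_apply]
    split_ifs with hxA <;> simp [hxA]

theorem proposition1p1 {G : Type*} [CommGroup G] [TopologicalSpace G] [IsTopologicalGroup G]
    [CompactSpace G] [MeasurableSpace G] [BorelSpace G]
    (μ : Measure G) [μ.IsHaarMeasure] [μ.Regular] [IsProbabilityMeasure μ]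
    (A : Set G) (hA : NullMeasurableSet A μ) (α : ℝ) (hα : μ.real A = α)
    (hV : ∀ V : Subgroup (PontryaginDual G), Finite V →
      0 < Int.fract (α * (Nat.card V : ℝ)) * (1 - Int.fract (α * (Nat.card V : ℝ)))) :
    A.indicator (fun _ => (1 : ℂ)) ∉ fourierAlgebra μ := by
  intro hmem
  have hLp : MemLp (A.indicator fun _ => (1 : ℂ)) 2 μ := by
    refine MemLp.of_bound hmem.1.aestronglyMeasurable 1 (.of_forall fun x => ?_)
    exact (norm_indicator_le_norm_self _ _).trans (by simp)
  obtain ⟨h, hh⟩ := exists_continuous_ae_eq_of_mem_fourierAlgebra μ hLp hmem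
  obtain ⟨B, hB, hAB⟩ := exists_isClopen_ae_eq_of_indicator_ae_eq hh
  obtain ⟨H, hH, hBH⟩ := exists_openSubgroup_mul_mem_of_isClopen hB
  have : Finite (G ⧸ H) := H.quotient_finite_of_isOpen hH
  have hcard := PontryaginDual.card_annihilator hH
  have hfin : Finite (PontryaginDual.annihilator H) := by
    refine Nat.finite_of_card_ne_zero ?_
    rw [hcard]
    exact Subgroup.index_ne_zero_of_finite
  have key := hV _ hfin
  rw [hcard, ← hα, measureReal_congr hAB, measureReal_mul_index_eq_ncard μ hH hBH] at key
  -- The fractional part of a natural number is `0`, so `key` reads `0 < 0`.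
  simp at key
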